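/- Fix $\omega_c>0$. There exist a constant $C>0$ (depending only on $\omega_c$) and a positive function $T_1=T_1(c_1,c_2)$ (hence $T_1$ depends only on $c_1,c_2,\omega_c$) with the following property. Let $v,r_d,c_1,c_2>0$ with $v/r_d=\omega_c$, let $\bar v_o,\bar a_o\ge 0$, put $\omega_o=\bar v_o/r_d$, and suppose $$(c_1-1)\omega_c>c_2+(c_1+1)\omega_o,\qquad c_2>\max\{(c_1+1)\omega_o,\ 2\omega_c+4\omega_o\}.$$ Then there is an $\epsilon>0$ with $$\epsilon\le C\left(\frac{v+\bar v_o+\bar a_o}{c_2}+\frac{v+\bar v_o}{c_1}\right)$$ such that the following holds for every $t_0\in\mathbb R$. Let a target in the plane move on $[t_0,\infty)$ by $\dot{\boldsymbol p}_o=\boldsymbol v_o$, $\dot{\boldsymbol v}_o=\boldsymbol a_o$ with $\|\boldsymbol v_o(t)\|_2\le\bar v_o$ and $\|\boldsymbol a_o(t)\|_2\le\bar a_o$, and let a vehicle move by $\dot{\boldsymbol p}=v(\cos\theta,\sin\theta)$, $\dot\theta=\omega$, under the range-based controller $$\omega(t)=\omega_c+c_1\dot e(t)+c_2\,\mathrm{sat}(e(t)),\qquad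 e(t)=\frac{d(t)-r_d}{r_d},\qquad d(t)=\|\boldsymbol p(t)-\boldsymbol p_o(t)\|_2,$$ where $\mathrm{sat}(z)=z$ for $|z|<1$ and $\mathrm{sat}(z)=\mathrm{sgn}(z)$ for $|z|\ge 1$. Here the heading $\theta$ is continuous and the equation $\dot\theta=\omega$ is required at all times with $d(t)\neq 0$. If $d(t_0)>2r_d+(v+\bar v_o)T_1$, then $$\limsup_{t\to\infty}|d(t)-r_d|\le\epsilon .$$ -/

import Mathlib

open Set Filter Topology

noncomputable section

namespace Circumnavigation

/-- The horizontal plane with its Euclidean norm. -/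
abbrev Plane : Type := EuclideanSpace ℝ (Fin 2)

/-- The saturation function: `z` for `|z| < 1` and `sgn z` for `|z| ≥ 1`. -/
def sat (z : ℝ) : ℝ := if |z| < 1 then z else Real.sign z

/-- The range `d(t)` from the vehicle (at `p t`) to the target (at `po t`). -/
def range (p po : ℝ → Plane) (t : ℝ) : ℝ := ‖p t - po t‖

/-- The relative tracking error `e(t) = (d(t) - r_d) / r_d`. -/
def trackingError (rd : ℝ) (p po : ℝ → Plane) (t : ℝ) : ℝ := (range p po t - rd) / rd

/-- The range-based controller `ω(t) = ω_c + c₁ e'(t) + c₂ sat (e(t))` with `ω_c = v / r_d`, on the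
time interval `[t₀, ∞)` (so the derivative at `t₀` is the right one). -/
def rangeBasedControl (v rd c₁ c₂ t₀ : ℝ) (p po : ℝ → Plane) (t : ℝ) : ℝ :=
  v / rd + c₁ * derivWithin (trackingError rd p po) (Ici t₀) t + c₂ * sat (trackingError rd p po t)

/-- A trajectory on `[t₀, ∞)` of the closed loop formed by a double-integrator target
`po' = vo`, `vo' = ao` and a vehicle of constant speed `v`, `p' = v (cos θ, sin θ)`, `θ' = ω`, whose
angular speed `ω` is given by the range-based controller.

The range is differentiable where it is not zero, and in general only there. The heading equation is
therefore required at the times where the range is not zero; if the vehicle passes through the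
target, its heading is only required to be continuous. -/
structure IsClosedLoop (v rd c₁ c₂ t₀ : ℝ) (po vo ao p : ℝ → Plane) (θ : ℝ → ℝ) : Prop where
  target_position : ∀ t, t₀ ≤ t → HasDerivWithinAt po (vo t) (Ici t₀) t
  target_velocity : ∀ t, t₀ ≤ t → HasDerivWithinAt vo (ao t) (Ici t₀) t
  vehicle_position : ∀ t, t₀ ≤ t →
    HasDerivWithinAt p (v • !₂[Real.cos (θ t), Real.sin (θ t)]) (Ici t₀) t
  heading_continuous : ContinuousOn θ (Ici t₀)
  heading : ∀ t, t₀ ≤ t → range p po t ≠ 0 →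
    HasDerivWithinAt θ (rangeBasedControl v rd c₁ c₂ t₀ p po t) (Ici t₀) t

end Circumnavigation

end

/-!
The proof follows the relative heading `ψ = θ - α`, where `α` is a continuous polar angle of the
vehicle seen from the target. Write `x = e'` and `ω_o = v̄_o / r_d`. While the range is positive,
`d' = v cos ψ - β` and `d α' = v sin ψ - γ` with `|β|, |γ| ≤ v̄_o`, and the controller gives
`ψ' = ω_c + c₁ x + c₂ sat e - α'` (`IsClosedLoop.exists_relHeading`).

Two facts about this equation suffice.

* At `cos ψ = -1` the term `c₁ x` dominates and `ψ' < 0` whenever `e ≥ 0`; at `cos ψ = 1` it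
  dominates with the opposite sign and `ψ' > 0` whenever `-1/2 ≤ e ≤ 0`. Hence `ψ` crosses odd
  multiples of `π` only downwards on an interval of the first kind, and even multiples only upwards
  on one of the second kind. Its net increase, respectively net decrease, is then at
  most `2π`, however long the interval.
* Integrating the equation, `c₁ Δe = Δψ - ∫ (ω_c + c₂ sat e - α')`. The integrand is bounded below by
  a positive constant while `e ≥ 2 (ω_c + ω_o) / c₂`, and it is nonpositive while
  `-1/2 ≤ e ≤ -3 (ω_c + ω_o) / c₂`.

So an excursion of `e` above the first level cannot rise by more than `2π / c₁` and cannot last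
forever (`IsClosedLoop.eventually_trackingError_le`), and one below the second level cannot fall by
more than `2π / c₁` (`IsClosedLoop.neg_le_trackingError`). The latter needs
`3 (ω_c + ω_o) / c₂ + 2π / c₁ < 1/2`, to keep the vehicle away from the target; otherwise the lower
bound `e ≥ -1` is already as good as the one required. Both estimates start from `d(t₀) ≥ r_d`, with
no condition on the initial heading, so that `T₁ = 1` will do.
-/

namespace Circumnavigation

/-! ### Crossings and barriers for real functions -/

lemma exists_last_crossing {f : ℝ → ℝ} {s t δ : ℝ} (hst : s ≤ t) (hf : ContinuousOn f (Icc s t))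
    (hs : f s ≤ δ) (ht : δ ≤ f t) :
    ∃ a ∈ Icc s t, f a = δ ∧ ∀ x ∈ Icc a t, δ ≤ f x := by
  have hc : IsCompact (Icc s t ∩ f ⁻¹' {δ}) :=
    isCompact_Icc.of_isClosed_subset
      (hf.preimage_isClosed_of_isClosed isClosed_Icc isClosed_singleton) inter_subset_left
  obtain ⟨c, hc1, hc2⟩ := intermediate_value_Icc hst hf ⟨hs, ht⟩
  obtain ⟨a, ⟨ha1, ha2⟩, hmax⟩ := hc.exists_isGreatest ⟨c, hc1, hc2⟩
  refine ⟨a, ha1, ha2, fun x hx => ?_⟩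
  by_contra! hlt
  have hx1 : s ≤ x := ha1.1.trans hx.1
  obtain ⟨y, hy1, hy2⟩ := intermediate_value_Icc hx.2
    (hf.mono (Icc_subset_Icc_left hx1)) ⟨hlt.le, ht⟩
  have hya : y ≤ a := hmax ⟨⟨hx1.trans hy1.1, hy1.2⟩, hy2⟩
  have hxa : x = a := le_antisymm (hy1.1.trans hya) hx.1
  rw [hxa, ha2] at hlt
  exact lt_irrefl _ hlt

lemma exists_first_crossing {f : ℝ → ℝ} {s t δ : ℝ} (hst : s ≤ t) (hf : ContinuousOn f (Icc s t))
    (hs : f s ≤ δ) (ht : δ ≤ f t) :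
    ∃ b ∈ Icc s t, f b = δ ∧ ∀ x ∈ Icc s b, f x ≤ δ := by
  have hg : ContinuousOn (fun x => -f (-x)) (Icc (-t) (-s)) :=
    (hf.comp continuousOn_neg fun x hx => ⟨by linarith [hx.2], by linarith [hx.1]⟩).neg
  obtain ⟨a, ha, h1, h2⟩ := exists_last_crossing (δ := -δ) (neg_le_neg hst) hg
    (by simpa using ht) (by simpa using hs)
  refine ⟨-a, ⟨by linarith [ha.2], by linarith [ha.1]⟩, neg_injective h1, fun x hx => ?_⟩
  have := h2 (-x) ⟨by linarith [hx.2], by linarith [hx.1]⟩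
  simpa using this

/-- If `f` decreases at an average rate `κ > 0`, up to an overshoot `M`, as long as it stays above
`δ`, then it is eventually at most `δ + M`. -/
lemma eventually_le_of_excursions {f : ℝ → ℝ} {t₀ δ M κ : ℝ} (hf : ContinuousOn f (Ici t₀))
    (hκ : 0 < κ) (hM : 0 ≤ M)
    (h : ∀ a b, t₀ ≤ a → a ≤ b → (∀ x ∈ Icc a b, δ ≤ f x) → f b ≤ f a + M - κ * (b - a)) :
    ∀ᶠ t in atTop, f t ≤ δ + M := by
  obtain ⟨s, hs, hsδ⟩ : ∃ s, t₀ ≤ s ∧ f s ≤ δ := by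
    by_contra! hgt
    set L : ℝ := |f t₀ + M - δ| / κ with hL
    have hLpos : 0 ≤ L := by positivity
    have h1 := h t₀ (t₀ + L) le_rfl (by linarith) fun x hx => (hgt x hx.1).le
    have h2 := hgt (t₀ + L) (by linarith)
    have h3 : κ * (t₀ + L - t₀) = |f t₀ + M - δ| := by
      rw [hL]; field_simp; ring
    linarith [le_abs_self (f t₀ + M - δ)]
  filter_upwards [eventually_ge_atTop s] with t ht
  rcases le_total (f t) δ with hle | hge
  · linarith
  · obtain ⟨a, ha, ha1, ha2⟩ := exists_last_crossing ht
      (hf.mono fun x hx => hs.trans hx.1) hsδ hge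
    have := h a t (hs.trans ha.1) ha.2 ha2
    nlinarith [mul_nonneg hκ.le (sub_nonneg.2 ha.2)]


/-- A function that decreases whenever it is at an odd multiple of `π` crosses these levels only
downwards, so that its net increase is at most one full turn. -/
lemma sub_le_two_pi_of_cos_eq_neg_one {ψ ψ' : ℝ → ℝ} {a b : ℝ} (hab : a ≤ b)
    (hψ : ∀ t ∈ Icc a b, HasDerivWithinAt ψ (ψ' t) (Ici a) t)
    (hbar : ∀ t ∈ Icc a b, Real.cos (ψ t) = -1 → ψ' t < 0) :
    ψ b - ψ a ≤ 2 * Real.pi := by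
  obtain ⟨k, ⟨hk1, hk2⟩, -⟩ :=
    existsUnique_add_zsmul_mem_Ioc Real.two_pi_pos (ψ a) (-Real.pi)
  rw [zsmul_eq_mul] at hk1 hk2
  have hcos : Real.cos (Real.pi - k * (2 * Real.pi)) = -1 := by
    rw [Real.cos_sub_int_mul_two_pi, Real.cos_pi]
  have := image_le_of_deriv_right_lt_deriv_boundary'
    (fun t ht => (hψ t ht).continuousWithinAt.mono Icc_subset_Ici_self)
    (fun t ht => (hψ t (Ico_subset_Icc_self ht)).mono (Ici_subset_Ici.2 ht.1))
    (B := fun _ => Real.pi - k * (2 * Real.pi)) (B' := fun _ => 0) (by linarith)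
    continuousOn_const (fun t _ => hasDerivWithinAt_const _ _ _)
    (fun t ht h => hbar t (Ico_subset_Icc_self ht) (by rw [h, hcos])) (right_mem_Icc.2 hab)
  linarith

/-- A function that increases whenever it is at an even multiple of `π` has net decrease at most one
full turn. -/
lemma sub_le_two_pi_of_cos_eq_one {ψ ψ' : ℝ → ℝ} {a b : ℝ} (hab : a ≤ b)
    (hψ : ∀ t ∈ Icc a b, HasDerivWithinAt ψ (ψ' t) (Ici a) t)
    (hbar : ∀ t ∈ Icc a b, Real.cos (ψ t) = 1 → 0 < ψ' t) :
    ψ a - ψ b ≤ 2 * Real.pi := by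
  have := sub_le_two_pi_of_cos_eq_neg_one hab (fun t ht => (hψ t ht).const_sub Real.pi)
    fun t ht h => neg_neg_of_pos (hbar t ht (by rw [Real.cos_pi_sub] at h; linarith))
  linarith

lemma le_of_hasDerivWithinAt_nonneg {f f' : ℝ → ℝ} {a b : ℝ} (hab : a ≤ b)
    (hf : ∀ t ∈ Icc a b, HasDerivWithinAt f (f' t) (Ici a) t)
    (hf' : ∀ t ∈ Icc a b, 0 ≤ f' t) : f a ≤ f b := by
  refine monotoneOn_of_hasDerivWithinAt_nonneg (convex_Icc a b) (f' := f')
    (fun t ht => (hf t ht).continuousWithinAt.mono Icc_subset_Ici_self)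
    (fun t ht => (hf t (interior_subset ht)).mono ?_) (fun t ht => hf' t (interior_subset ht))
    (left_mem_Icc.2 hab) (right_mem_Icc.2 hab) hab
  exact interior_subset.trans Icc_subset_Ici_self

/-! ### Polar coordinates along a plane curve -/

/-- A curve in `ℂ ∖ {0}` has a continuous polar angle `α` on a compact interval, with
`α' = Im (w / z)` if `z' = w`; it is obtained by integrating `w / z`. -/
lemma exists_polar_angle {z w : ℝ → ℂ} {a b : ℝ} (hab : a ≤ b)
    (hz : ∀ t ∈ Icc a b, HasDerivWithinAt z (w t) (Ici a) t) (hw : ContinuousOn w (Icc a b))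
    (h0 : ∀ t ∈ Icc a b, z t ≠ 0) :
    ∃ α : ℝ → ℝ, ∀ t ∈ Icc a b, HasDerivAt α (w t / z t).im t ∧
      z t = ‖z t‖ * Complex.exp (α t * Complex.I) := by
  have hzc : ContinuousOn z (Icc a b) :=
    fun t ht => (hz t ht).continuousWithinAt.mono Icc_subset_Ici_self
  -- Extending `w / z` beyond `[a, b]` by constants makes its primitive differentiable everywhere.
  set q : ℝ → ℂ := IccExtend hab ((Icc a b).domRestrict fun t => w t / z t) with hq
  have hqc : Continuous q := (hw.div hzc h0).domRestrict.Icc_extend'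
  have hqe : ∀ t ∈ Icc a b, q t = w t / z t := fun t ht => by
    rw [hq, IccExtend_of_mem hab _ ht, domRestrict_apply]
  set g : ℝ → ℂ := fun t => Complex.log (z a) + ∫ s in a..t, q s with hg
  have hgd : ∀ t, HasDerivAt g (q t) t := fun t =>
    (hqc.integral_hasStrictDerivAt a t).hasDerivAt.const_add _
  have hconst : ∀ t ∈ Icc a b, z t * Complex.exp (-g t) = z a * Complex.exp (-g a) := by
    refine constant_of_has_deriv_right_zero
      (hzc.mul (Complex.continuous_exp.comp_continuousOn
        fun t _ => (hgd t).continuousAt.neg.continuousWithinAt)) fun t ht => ?_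
    have ht' := Ico_subset_Icc_self ht
    have h1 := ((hz t ht').mono (Ici_subset_Ici.2 ht.1)).mul
      ((hgd t).neg.cexp.hasDerivWithinAt (s := Ici t))
    refine h1.congr_deriv ?_
    rw [hqe t ht']
    have := h0 t ht'
    simp only [Pi.neg_apply]
    field_simp
    ring
  have hexp : ∀ t ∈ Icc a b, z t = Complex.exp (g t) := fun t ht => by
    have h1 := hconst t ht
    have h2 : z a * Complex.exp (-g a) = 1 := by
      have h3 : g a = Complex.log (z a) := by simp [hg]
      rw [h3, Complex.exp_neg, Complex.exp_log (h0 a (left_mem_Icc.2 hab)),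
        mul_inv_cancel₀ (h0 a (left_mem_Icc.2 hab))]
    rw [h2, Complex.exp_neg] at h1
    exact (mul_inv_eq_one₀ (Complex.exp_ne_zero _)).1 h1
  refine ⟨fun t => (g t).im, fun t ht => ⟨?_, ?_⟩⟩
  · rw [← hqe t ht]
    exact Complex.imCLM.hasFDerivAt.comp_hasDerivAt t (hgd t)
  · rw [hexp t ht, Complex.norm_exp, Complex.ofReal_exp, ← Complex.exp_add, Complex.re_add_im]

lemma hasDerivWithinAt_norm_of_ne_zero {z : ℝ → ℂ} {w : ℂ} {s : Set ℝ} {t : ℝ}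
    (hz : HasDerivWithinAt z w s t) (h0 : z t ≠ 0) :
    HasDerivWithinAt (fun x => ‖z x‖) (‖z t‖ * (w / z t).re) s t := by
  have hn : ‖z t‖ ≠ 0 := norm_ne_zero_iff.2 h0
  have h1 := hz.norm_sq.sqrt (pow_ne_zero 2 hn)
  simp only [Real.sqrt_sq (norm_nonneg _)] at h1
  refine h1.congr_deriv ?_
  rw [Complex.inner, Complex.div_re, Complex.normSq_eq_norm_sq, Complex.mul_re, Complex.conj_re,
    Complex.conj_im]
  field_simp
  ring

/-! ### The relative heading of the closed loop -/

variable {v rd c₁ c₂ t₀ vbar : ℝ} {po vo ao p : ℝ → Plane} {θ : ℝ → ℝ}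

/-- The closed loop in polar coordinates about the target, on an interval without collision. Here `ψ`
is the heading relative to the line of sight, and `β t`, `γ t` are the components of the target
velocity along and across the line of sight. -/
lemma IsClosedLoop.exists_relHeading (h : IsClosedLoop v rd c₁ c₂ t₀ po vo ao p θ)
    (hvo : ∀ t, t₀ ≤ t → ‖vo t‖ ≤ vbar) {a b : ℝ} (ha : t₀ ≤ a) (hab : a ≤ b)
    (h0 : ∀ t ∈ Icc a b, range p po t ≠ 0) :
    ∃ ψ β γ : ℝ → ℝ, ∀ t ∈ Icc a b, |β t| ≤ vbar ∧ |γ t| ≤ vbar ∧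
      HasDerivWithinAt (trackingError rd p po) ((v * Real.cos (ψ t) - β t) / rd) (Ici a) t ∧
      HasDerivWithinAt ψ (v / rd + c₁ * ((v * Real.cos (ψ t) - β t) / rd)
        + c₂ * sat (trackingError rd p po t)
        - (v * Real.sin (ψ t) - γ t) / range p po t) (Ici a) t := by
  set iso : Plane ≃ₗᵢ[ℝ] ℂ := Complex.orthonormalBasisOneI.repr.symm with hiso
  set z : ℝ → ℂ := fun t => iso (p t - po t) with hz
  set w : ℝ → ℂ := fun t => v * Complex.exp (θ t * Complex.I) - iso (vo t) with hw
  have hzn : ∀ t, ‖z t‖ = range p po t := fun t => iso.norm_map _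
  have hdir : ∀ x : ℝ, iso (v • !₂[Real.cos x, Real.sin x]) = v * Complex.exp (x * Complex.I) := by
    intro x
    rw [map_smul, hiso, Complex.real_smul]
    simp [Complex.exp_mul_I]
  have hzd : ∀ t, t₀ ≤ t → HasDerivWithinAt z (w t) (Ici t₀) t := fun t ht => by
    have h1 := iso.toContinuousLinearEquiv.hasFDerivAt.comp_hasDerivWithinAt t
      ((h.vehicle_position t ht).sub (h.target_position t ht))
    refine h1.congr_deriv ?_
    change iso _ = _
    rw [map_sub, hdir]
  have hz0 : ∀ t ∈ Icc a b, z t ≠ 0 := fun t ht => by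
    rw [← norm_ne_zero_iff, hzn]; exact h0 t ht
  have hwc : ContinuousOn w (Ici t₀) := by
    have hvc : ContinuousOn vo (Ici t₀) := fun t ht => (h.target_velocity t ht).continuousWithinAt
    have h1 : ContinuousOn (fun t => Complex.exp (θ t * Complex.I)) (Ici t₀) :=
      Complex.continuous_exp.comp_continuousOn
        ((Complex.continuous_ofReal.comp_continuousOn h.heading_continuous).mul continuousOn_const)
    exact (continuousOn_const.mul h1).sub (iso.continuous.comp_continuousOn hvc)
  have hIci : Ici a ⊆ Ici t₀ := Ici_subset_Ici.2 ha
  obtain ⟨α, hα⟩ := exists_polar_angle hab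
    (fun t ht => (hzd t (ha.trans ht.1)).mono hIci)
    (hwc.mono (Icc_subset_Ici_self.trans hIci)) hz0
  set B : ℝ → ℂ := fun t => iso (vo t) * Complex.exp (-(α t * Complex.I)) with hB
  have hBn : ∀ t, t₀ ≤ t → ‖B t‖ ≤ vbar := fun t ht => by
    have h1 : ‖Complex.exp (-(α t * Complex.I))‖ = 1 := by
      rw [← neg_mul, ← Complex.ofReal_neg, Complex.norm_exp_ofReal_mul_I]
    rw [hB, norm_mul, h1, mul_one, iso.norm_map]
    exact hvo t ht
  have hquot : ∀ t ∈ Icc a b,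
      w t / z t = (v * Complex.exp ((θ t - α t : ℝ) * Complex.I) - B t) / (range p po t : ℝ) := by
    intro t ht
    have h1 : (range p po t : ℂ) ≠ 0 := Complex.ofReal_ne_zero.2 (h0 t ht)
    have h2 := Complex.exp_ne_zero (α t * Complex.I)
    rw [(hα t ht).2, hzn, Complex.ofReal_sub, sub_mul, Complex.exp_sub]
    simp only [hw, hB, Complex.exp_neg]
    generalize Complex.exp (α t * Complex.I) = E at h2
    field_simp
  have hre : ∀ t ∈ Icc a b,
      (w t / z t).re = (v * Real.cos (θ t - α t) - (B t).re) / range p po t := fun t ht => by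
    rw [hquot t ht, Complex.div_ofReal_re, Complex.sub_re, Complex.re_ofReal_mul,
      Complex.exp_ofReal_mul_I_re]
  have him : ∀ t ∈ Icc a b,
      (w t / z t).im = (v * Real.sin (θ t - α t) - (B t).im) / range p po t := fun t ht => by
    rw [hquot t ht, Complex.div_ofReal_im, Complex.sub_im, Complex.im_ofReal_mul,
      Complex.exp_ofReal_mul_I_im]
  refine ⟨fun t => θ t - α t, fun t => (B t).re, fun t => (B t).im, fun t ht => ?_⟩
  have ht₀ : t₀ ≤ t := ha.trans ht.1
  have he : HasDerivWithinAt (trackingError rd p po)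
      ((v * Real.cos (θ t - α t) - (B t).re) / rd) (Ici t₀) t := by
    have h1 := ((hasDerivWithinAt_norm_of_ne_zero (hzd t ht₀) (hz0 t ht)).sub_const rd).div_const rd
    simp only [hzn] at h1
    refine h1.congr_deriv ?_
    rw [hre t ht, mul_div_cancel₀ _ (h0 t ht)]
  refine ⟨(Complex.abs_re_le_norm _).trans (hBn t ht₀),
    (Complex.abs_im_le_norm _).trans (hBn t ht₀), he.mono hIci, ?_⟩
  have h1 := ((h.heading t ht₀ (h0 t ht)).mono hIci).sub (hα t ht).1.hasDerivWithinAt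
  refine h1.congr_deriv ?_
  rw [him t ht, rangeBasedControl, he.derivWithin (uniqueDiffOn_Ici t₀ t ht₀)]

lemma IsClosedLoop.continuousOn_trackingError (h : IsClosedLoop v rd c₁ c₂ t₀ po vo ao p θ) :
    ContinuousOn (trackingError rd p po) (Ici t₀) := fun t ht =>
  ((((h.vehicle_position t ht).continuousWithinAt.sub
    (h.target_position t ht).continuousWithinAt).norm.sub continuousWithinAt_const).div_const rd)

lemma range_eq_mul_one_add (hrd : 0 < rd) (t : ℝ) :
    range p po t = rd * (1 + trackingError rd p po t) := by
  rw [trackingError]; field_simp; ring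

/-! ### Excursions of the tracking error -/

lemma sat_of_abs_lt_one {z : ℝ} (hz : |z| < 1) : sat z = z := if_pos hz

lemma sat_le_one (z : ℝ) : sat z ≤ 1 := by
  rw [sat]
  split_ifs with h
  · exact (le_abs_self z).trans h.le
  · rcases Real.sign_apply_eq z with h | h | h <;> rw [h] <;> norm_num

lemma le_sat {δ z : ℝ} (h0 : 0 ≤ δ) (h1 : δ ≤ 1) (hz : δ ≤ z) : δ ≤ sat z := by
  rw [sat]
  split_ifs with h
  · exact hz
  · have hz0 : 0 < z := (h0.trans hz).lt_of_ne fun h' => h (by rw [← h', abs_zero]; exact one_pos)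
    rwa [Real.sign_of_pos hz0]

lemma abs_mul_sin_sub_le (hv : 0 < v) {x γ : ℝ} (hγ : |γ| ≤ vbar) :
    |v * Real.sin x - γ| ≤ v + vbar := by
  refine (abs_sub _ _).trans (add_le_add ?_ hγ)
  rw [abs_mul, abs_of_pos hv]
  exact mul_le_of_le_one_right hv.le (Real.abs_sin_le_one x)

/-- A component of a velocity of size at most `u`, divided by a range of at least `rd / k`. -/
lemma abs_div_range_le {k u y D : ℝ} (hrd : 0 < rd) (hD : rd ≤ k * D) (hD0 : 0 < D)
    (hy : |y| ≤ u) : |y / D| ≤ k * (u / rd) := by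
  rw [abs_div, abs_of_pos hD0, div_le_iff₀ hD0]
  have hu : 0 ≤ u := (abs_nonneg y).trans hy
  calc |y| ≤ u := hy
    _ = u / rd * rd := by field_simp
    _ ≤ u / rd * (k * D) := by gcongr
    _ = k * (u / rd) * D := by ring

/-- The tracking error eventually stays below the level `2 (ω_c + ω_o) / c₂`, up to the overshoot
`2π / c₁` due to one turn of the relative heading. -/
lemma IsClosedLoop.eventually_trackingError_le (h : IsClosedLoop v rd c₁ c₂ t₀ po vo ao p θ)
    (hvo : ∀ t, t₀ ≤ t → ‖vo t‖ ≤ vbar) (hv : 0 < v) (hrd : 0 < rd) (hvbar : 0 ≤ vbar)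
    (hc₁ : 0 < c₁) (hc₂ : 0 < c₂) (hgain : c₂ + (c₁ + 1) * (vbar / rd) < (c₁ - 1) * (v / rd))
    (hsat : 2 * (v / rd) + 4 * (vbar / rd) < c₂) :
    ∀ᶠ t in atTop, trackingError rd p po t
      ≤ 2 * (v / rd + vbar / rd) / c₂ + 2 * Real.pi / c₁ := by
  have hW : 0 < v / rd := div_pos hv hrd
  have hO : 0 ≤ vbar / rd := div_nonneg hvbar hrd.le
  set W := v / rd with hWdef
  set O := vbar / rd with hOdef
  set δ := 2 * (W + O) / c₂ with hδ
  have hδ0 : 0 ≤ δ := by positivity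
  have hδ1 : δ ≤ 1 := (div_le_one hc₂).2 (by linarith)
  refine eventually_le_of_excursions h.continuousOn_trackingError (κ := (2 * W + O) / c₁)
    (by positivity) (by positivity [Real.pi_pos]) fun a b ha hab hlev => ?_
  have hD : ∀ t ∈ Icc a b, rd ≤ 1 * range p po t := fun t ht => by
    rw [one_mul, range_eq_mul_one_add hrd]
    nlinarith [hlev t ht]
  have hD0 : ∀ t ∈ Icc a b, 0 < range p po t := fun t ht => by linarith [hD t ht]
  obtain ⟨ψ, β, γ, hψ⟩ := h.exists_relHeading hvo ha hab fun t ht => (hD0 t ht).ne'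
  have hturn : ψ b - ψ a ≤ 2 * Real.pi := by
    refine sub_le_two_pi_of_cos_eq_neg_one hab (fun t ht => (hψ t ht).2.2.2) fun t ht hcos => ?_
    obtain ⟨hβ, hγ, -, -⟩ := hψ t ht
    have hsin : Real.sin (ψ t) = 0 := Real.sin_eq_zero_iff_cos_eq.2 (Or.inr hcos)
    have h1 := (abs_le.1 (abs_div_range_le hrd (hD t ht) (hD0 t ht) hγ)).2
    have h2 := (abs_le.1 (abs_div_range_le (k := 1) hrd (by rw [one_mul]) hrd hβ)).1
    have h3 := mul_le_mul_of_nonneg_left (sat_le_one (trackingError rd p po t)) hc₂.le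
    have h4 : c₁ * (-W - β t / rd) ≤ c₁ * (-W + O) :=
      mul_le_mul_of_nonneg_left (by linarith) hc₁.le
    have h5 : (v * -1 - β t) / rd = -W - β t / rd := by rw [hWdef]; ring
    have h6 : (v * 0 - γ t) / range p po t = -(γ t / range p po t) := by ring
    rw [hcos, hsin, h5, h6]
    linarith
  have hmono := le_of_hasDerivWithinAt_nonneg hab
    (fun t ht => ((hψ t ht).2.2.2.sub ((hψ t ht).2.2.1.const_mul c₁)).sub
      ((hasDerivWithinAt_id t (Ici a)).const_mul (2 * W + O))) fun t ht => by
    obtain ⟨-, hγ, -, -⟩ := hψ t ht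
    have h1 := (abs_le.1 (abs_div_range_le hrd (hD t ht) (hD0 t ht)
      (abs_mul_sin_sub_le hv (x := ψ t) hγ))).2
    have h2 := mul_le_mul_of_nonneg_left (le_sat hδ0 hδ1 (hlev t ht)) hc₂.le
    have h3 : c₂ * δ = 2 * (W + O) := by rw [hδ]; field_simp
    rw [add_div] at h1
    linarith
  have hlin : c₁ * (trackingError rd p po b - trackingError rd p po a)
      ≤ 2 * Real.pi - (2 * W + O) * (b - a) := by
    simp only [Pi.sub_apply, id] at hmono
    linarith
  have hdiv : trackingError rd p po b - trackingError rd p po a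
      ≤ (2 * Real.pi - (2 * W + O) * (b - a)) / c₁ := by
    rwa [le_div_iff₀' hc₁]
  have hsplit : (2 * Real.pi - (2 * W + O) * (b - a)) / c₁
      = 2 * Real.pi / c₁ - (2 * W + O) / c₁ * (b - a) := by ring
  linarith

/-- While `-1/2 ≤ e ≤ -3 (ω_c + ω_o) / c₂`, the tracking error falls by at most `2π / c₁`. -/
lemma IsClosedLoop.trackingError_sub_le (h : IsClosedLoop v rd c₁ c₂ t₀ po vo ao p θ)
    (hvo : ∀ t, t₀ ≤ t → ‖vo t‖ ≤ vbar) (hv : 0 < v) (hrd : 0 < rd) (hvbar : 0 ≤ vbar)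
    (hc₁ : 0 < c₁) (hc₂ : 0 < c₂) (hgain : c₂ + (c₁ + 1) * (vbar / rd) < (c₁ - 1) * (v / rd))
    (hsat : 2 * (v / rd) + 4 * (vbar / rd) < c₂) {a b : ℝ} (ha : t₀ ≤ a) (hab : a ≤ b)
    (hlev : ∀ t ∈ Icc a b, -(1 / 2) ≤ trackingError rd p po t ∧
      trackingError rd p po t ≤ -(3 * (v / rd + vbar / rd) / c₂)) :
    trackingError rd p po a - trackingError rd p po b ≤ 2 * Real.pi / c₁ := by
  have hW : 0 < v / rd := div_pos hv hrd
  have hO : 0 ≤ vbar / rd := div_nonneg hvbar hrd.le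
  set W := v / rd with hWdef
  set O := vbar / rd with hOdef
  set δ := 3 * (W + O) / c₂ with hδ
  have hδ0 : 0 ≤ δ := by positivity
  have hsat_eq : ∀ t ∈ Icc a b, sat (trackingError rd p po t) = trackingError rd p po t :=
    fun t ht => sat_of_abs_lt_one
      (abs_lt.2 ⟨by linarith [(hlev t ht).1], by linarith [(hlev t ht).2]⟩)
  have hD : ∀ t ∈ Icc a b, rd ≤ 2 * range p po t := fun t ht => by
    rw [range_eq_mul_one_add hrd]
    nlinarith [(hlev t ht).1]
  have hD0 : ∀ t ∈ Icc a b, 0 < range p po t := fun t ht => by linarith [hD t ht]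
  obtain ⟨ψ, β, γ, hψ⟩ := h.exists_relHeading hvo ha hab fun t ht => (hD0 t ht).ne'
  have hturn : ψ a - ψ b ≤ 2 * Real.pi := by
    refine sub_le_two_pi_of_cos_eq_one hab (fun t ht => (hψ t ht).2.2.2) fun t ht hcos => ?_
    obtain ⟨hβ, hγ, -, -⟩ := hψ t ht
    have hsin : Real.sin (ψ t) = 0 := Real.sin_eq_zero_iff_cos_eq.2 (Or.inl hcos)
    have h1 := (abs_le.1 (abs_div_range_le hrd (hD t ht) (hD0 t ht) hγ)).1
    have h2 := (abs_le.1 (abs_div_range_le (k := 1) hrd (by rw [one_mul]) hrd hβ)).2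
    have h3 := mul_le_mul_of_nonneg_left (hlev t ht).1 hc₂.le
    have h4 : c₁ * (W - O) ≤ c₁ * (W - β t / rd) :=
      mul_le_mul_of_nonneg_left (by linarith) hc₁.le
    have h5 : (v * 1 - β t) / rd = W - β t / rd := by rw [hWdef]; ring
    have h6 : (v * 0 - γ t) / range p po t = -(γ t / range p po t) := by ring
    rw [hcos, hsin, hsat_eq t ht, h5, h6]
    linarith
  have hmono := le_of_hasDerivWithinAt_nonneg hab
    (fun t ht => ((hψ t ht).2.2.1.const_mul c₁).sub (hψ t ht).2.2.2) fun t ht => by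
    obtain ⟨-, hγ, -, -⟩ := hψ t ht
    have h1 := (abs_le.1 (abs_div_range_le hrd (hD t ht) (hD0 t ht)
      (abs_mul_sin_sub_le hv (x := ψ t) hγ))).1
    have h2 := mul_le_mul_of_nonneg_left (hlev t ht).2 hc₂.le
    have h3 : c₂ * -δ = -(3 * (W + O)) := by rw [hδ]; field_simp
    rw [add_div] at h1
    rw [hsat_eq t ht]
    linarith
  rw [le_div_iff₀' hc₁]
  simp only [Pi.sub_apply] at hmono
  linarith

/-- For large gains the tracking error never falls below a small negative level. -/
lemma IsClosedLoop.neg_le_trackingError (h : IsClosedLoop v rd c₁ c₂ t₀ po vo ao p θ)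
    (hvo : ∀ t, t₀ ≤ t → ‖vo t‖ ≤ vbar) (hv : 0 < v) (hrd : 0 < rd) (hvbar : 0 ≤ vbar)
    (hc₁ : 0 < c₁) (hc₂ : 0 < c₂) (hgain : c₂ + (c₁ + 1) * (vbar / rd) < (c₁ - 1) * (v / rd))
    (hsat : 2 * (v / rd) + 4 * (vbar / rd) < c₂) (hinit : 0 ≤ trackingError rd p po t₀)
    (hsmall : 3 * (v / rd + vbar / rd) / c₂ + 2 * Real.pi / c₁ < 1 / 2) {t : ℝ} (ht : t₀ ≤ t) :
    -(3 * (v / rd + vbar / rd) / c₂ + 2 * Real.pi / c₁) ≤ trackingError rd p po t := by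
  by_contra! hlt
  have hδ0 : 0 ≤ 3 * (v / rd + vbar / rd) / c₂ := by positivity
  have hov : 0 ≤ 2 * Real.pi / c₁ := by positivity [Real.pi_pos]
  set δ := 3 * (v / rd + vbar / rd) / c₂ with hδ
  -- `-η` is a level below the claimed one, reached by `e`, at which the range is still positive.
  set η := min (-trackingError rd p po t) (1 / 2) with hη
  have hη1 : δ + 2 * Real.pi / c₁ < η := lt_min (by linarith) hsmall
  have hη2 : η ≤ 1 / 2 := min_le_right _ _
  have hcont := h.continuousOn_trackingError.neg
  obtain ⟨b, hb, hbη, hbfirst⟩ := exists_first_crossing ht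
    (hcont.mono Icc_subset_Ici_self) (δ := η) (by simp only [Pi.neg_apply]; linarith)
    (min_le_left _ _)
  obtain ⟨a, ha, haδ, halast⟩ := exists_last_crossing hb.1
    (hcont.mono Icc_subset_Ici_self) (δ := δ) (by simp only [Pi.neg_apply]; linarith)
    (by rw [hbη]; linarith)
  simp only [Pi.neg_apply] at hbη hbfirst haδ halast
  have := h.trackingError_sub_le hvo hv hrd hvbar hc₁ hc₂ hgain hsat ha.1 ha.2 fun x hx =>
    ⟨by linarith [hbfirst x ⟨ha.1.trans hx.1, hx.2⟩], by linarith [halast x hx]⟩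
  linarith

end Circumnavigation

theorem proposition2 (ωc : ℝ) (hωc : 0 < ωc) :
    ∃ C : ℝ, 0 < C ∧ ∃ T₁ : ℝ → ℝ → ℝ, (∀ c₁ c₂ : ℝ, 0 < T₁ c₁ c₂) ∧
      ∀ v rd vbar abar c₁ c₂ : ℝ, 0 < v → 0 < rd → v / rd = ωc →
        0 ≤ vbar → 0 ≤ abar → 0 < c₁ → 0 < c₂ →
        (c₁ - 1) * ωc > c₂ + (c₁ + 1) * (vbar / rd) →
        c₂ > max ((c₁ + 1) * (vbar / rd)) (2 * ωc + 4 * (vbar / rd)) →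
        ∃ ε : ℝ, 0 < ε ∧ ε ≤ C * ((v + vbar + abar) / c₂ + (v + vbar) / c₁) ∧
          ∀ (t₀ : ℝ) (po vo ao p : ℝ → Circumnavigation.Plane) (θ : ℝ → ℝ),
            Circumnavigation.IsClosedLoop v rd c₁ c₂ t₀ po vo ao p θ →
            (∀ t, t₀ ≤ t → ‖vo t‖ ≤ vbar) →
            (∀ t, t₀ ≤ t → ‖ao t‖ ≤ abar) →
            Circumnavigation.range p po t₀ > 2 * rd + (v + vbar) * T₁ c₁ c₂ →
            IsBoundedUnder (· ≤ ·) atTop (fun t => |Circumnavigation.range p po t - rd|) ∧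
              limsup (fun t => |Circumnavigation.range p po t - rd|) atTop ≤ ε := by
  have hπ := Real.pi_pos
  refine ⟨6 + 4 * Real.pi / ωc, by positivity, fun _ _ => 1, fun _ _ => one_pos, ?_⟩
  intro v rd vbar abar c₁ c₂ hv hrd hω hvbar habar hc₁ hc₂ hgain hmax
  have hvω : v = ωc * rd := by rw [← hω]; field_simp
  refine ⟨(6 + 4 * Real.pi / ωc) * ((v + vbar + abar) / c₂ + (v + vbar) / c₁), by positivity,
    le_rfl, ?_⟩
  intro t₀ po vo ao p θ h hvo _ hfar
  rw [← hω] at hgain hmax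
  have hsat := (le_max_right _ _).trans_lt hmax
  have hinit : 0 ≤ Circumnavigation.trackingError rd p po t₀ :=
    div_nonneg (by linarith) hrd.le
  -- All bounds on `e` obtained from the excursions are of the size of `m`.
  set m := 3 * (v / rd + vbar / rd) / c₂ + 2 * Real.pi / c₁ with hm
  have hm0 : 0 ≤ m := by positivity
  have hmε : rd * (2 * m)
      ≤ (6 + 4 * Real.pi / ωc) * ((v + vbar + abar) / c₂ + (v + vbar) / c₁) := by
    have h1 : rd * (2 * m) = 6 * ((v + vbar) / c₂) + 4 * Real.pi / ωc * (v / c₁) := by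
      rw [hm, hvω]; field_simp; ring
    have h2 : (v + vbar) / c₂ ≤ (v + vbar + abar) / c₂ :=
      div_le_div_of_nonneg_right (by linarith) hc₂.le
    have h3 : v / c₁ ≤ (v + vbar) / c₁ := div_le_div_of_nonneg_right (by linarith) hc₁.le
    have h4 : 4 * Real.pi / ωc * (v / c₁) ≤ 4 * Real.pi / ωc * ((v + vbar) / c₁) := by gcongr
    have h5 : 0 ≤ 4 * Real.pi / ωc * ((v + vbar + abar) / c₂) := by positivity
    have h6 : 0 ≤ (v + vbar) / c₁ := by positivity
    linarith
  have hlow : ∀ t, t₀ ≤ t → -(2 * m) ≤ Circumnavigation.trackingError rd p po t := by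
    intro t ht
    rcases lt_or_ge m (1 / 2) with hsmall | hlarge
    · have := h.neg_le_trackingError hvo hv hrd hvbar hc₁ hc₂ hgain hsat hinit hsmall ht
      linarith
    · have h1 : -1 ≤ Circumnavigation.trackingError rd p po t := by
        rw [Circumnavigation.trackingError, le_div_iff₀ hrd]
        have : 0 ≤ Circumnavigation.range p po t := norm_nonneg _
        linarith
      linarith
  have hev : ∀ᶠ t in atTop, |Circumnavigation.range p po t - rd|
      ≤ (6 + 4 * Real.pi / ωc) * ((v + vbar + abar) / c₂ + (v + vbar) / c₁) := by
    filter_upwards [h.eventually_trackingError_le hvo hv hrd hvbar hc₁ hc₂ hgain hsat,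
      eventually_ge_atTop t₀] with t hup ht
    have hup' : Circumnavigation.trackingError rd p po t ≤ 2 * m := by
      have h1 : 2 * (v / rd + vbar / rd) / c₂ ≤ 3 * (v / rd + vbar / rd) / c₂ := by
        gcongr; norm_num
      linarith
    have h2 : Circumnavigation.range p po t - rd
        = rd * Circumnavigation.trackingError rd p po t := by
      rw [Circumnavigation.range_eq_mul_one_add hrd]; ring
    rw [h2, abs_mul, abs_of_pos hrd]
    exact (mul_le_mul_of_nonneg_left (abs_le.2 ⟨hlow t ht, hup'⟩) hrd.le).trans hmε
  exact ⟨⟨_, hev⟩, limsup_le_of_le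
    (isCoboundedUnder_le_of_le atTop (x := 0) fun _ => abs_nonneg _) hev⟩
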